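/- Let $S$ be a finite set with at least two elements, let $P$ be the transition matrix of an irreducible, aperiodic Markov chain on $S$, let $\pi$ be its stationary distribution, and let $j\in S$. Let $(X_t)_{t\ge 0}$ be a Markov chain with transition matrix $P$ and $X_0\sim\pi$, and let $W_j=\inf\{t\ge 0: X_t=j\}$. Let $T^{(j)}$ be any strong stationary time for a Markov chain $(X'_t)_{t\ge0}$ with transition matrix $P$ and initial distribution $\pi^{(j)}=(\pi-\pi_j\delta_j)/(1-\pi_j)$; that is, $T^{(j)}$ is an almost surely finite randomized stopping time for $X'$ (a stopping time of some filtration to which $X'$ is adapted and with respect to which $X'$ is a Markov chain with transition matrix $P$) such that $X'_{T^{(j)}}\sim\pi$ and $X'_{T^{(j)}}$ is independent of $T^{(j)}$. Let $U=T^{(j)}_1+\cdots+T^{(j)}_N$, where $T^{(j)}_1,T^{(j)}_2,\ldots$ are independent copies of $T^{(j)}$ and $N$ is independent of $(T^{(j)}_i)_{i\ge1}$ with $\mathbb{P}(N=k)=\pi_j(1-\pi_j)^k$ for $k=0,1,2,\ldots$. Then $W_j<\infty$ almost surely, and $U\ge_{st}W_j$, i.e. $\mathbb{E}h(U)\ge\mathbb{E}h(W_j)$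 for every increasing function $h:\{0,1,2,\ldots\}\to\mathbb{R}$, where the expectations take values in $(-\infty,\infty]$. -/

import Mathlib

open MeasureTheory ProbabilityTheory
open scoped ENNReal Matrix

namespace HitGeom

section Matrices

variable {S : Type*} [Fintype S] [DecidableEq S]

/-- Every state has period one: the only common divisor of the possible return times
`{n ≥ 1 : Pⁿ(x,x) > 0}` is `1`. -/
def IsAperiodic (P : Matrix S S ℝ) : Prop :=
  ∀ (x : S) (d : ℕ), (∀ n : ℕ, 1 ≤ n → 0 < (P ^ n) x x → d ∣ n) → d = 1

/-- `P` is the transition matrix of an irreducible, ergodic (aperiodic) chain on the finite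
state space `S`. -/
structure IsErgodicTransitionMatrix (P : Matrix S S ℝ) : Prop where
  rowStochastic : P ∈ Matrix.rowStochastic ℝ S
  irreducible : P.IsIrreducible
  aperiodic : IsAperiodic P

/-- `π` is a stationary probability vector of `P`: `π P = π`. -/
structure IsStationary (P : Matrix S S ℝ) (π : S → ℝ) : Prop where
  mem_stdSimplex : π ∈ stdSimplex ℝ S
  invariant : π ᵥ* P = π

/-- The restriction of `π` to the states other than `j`, `(π - π_j δ_j) / (1 - π_j)`. -/
noncomputable def restrictAway (π : S → ℝ) (j : S) : S → ℝ :=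
  fun s => (π s - π j * (Pi.single j (1 : ℝ) : S → ℝ) s) / (1 - π j)

end Matrices

section Chains

variable {S : Type*} [MeasurableSpace S]
variable {Ω : Type*} [mΩ : MeasurableSpace Ω]

/-- `X` is, under `μ`, a Markov chain with initial distribution `ν` and transition matrix `P`
(finite-dimensional distributions). -/
structure IsMarkovChain (P : Matrix S S ℝ) (ν : S → ℝ) (X : ℕ → Ω → S) (μ : Measure Ω) :
    Prop where
  measurable : ∀ t, Measurable (X t)
  path_prob : ∀ (n : ℕ) (x : ℕ → S),
    μ {ω | ∀ i ≤ n, X i ω = x i} =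
      ENNReal.ofReal (ν (x 0) * ∏ i ∈ Finset.range n, P (x i) (x (i + 1)))

/-- `T` is a randomized stopping time for the chain `X` with transition matrix `P`: a stopping
time of some filtration `F` (which may carry additional randomization) to which `X` is adapted
and with respect to which `X` is still a Markov chain with transition matrix `P`. -/
def IsRandomizedStoppingTime (P : Matrix S S ℝ) (X : ℕ → Ω → S) (μ : Measure Ω)
    (T : Ω → ℕ∞) : Prop :=
  ∃ F : Filtration ℕ mΩ,
    (∀ t, Measurable[F t] (X t)) ∧
    (∀ (t : ℕ) (A : Set Ω), MeasurableSet[F t] A → ∀ x y : S,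
      μ (A ∩ {ω | X t ω = x} ∩ {ω | X (t + 1) ω = y}) =
        μ (A ∩ {ω | X t ω = x}) * ENNReal.ofReal (P x y)) ∧
    IsStoppingTime F T

/-- `T` is a strong stationary time for the chain `X` with transition matrix `P` and stationary
distribution `π`: an almost surely finite randomized stopping time such that `X_T` has
distribution `π` and is independent of `T`. (The value of `X_T` on the null event `T = ∞` is
irrelevant.) -/
structure IsStrongStationaryTime (P : Matrix S S ℝ) (π : S → ℝ) (X : ℕ → Ω → S)
    (μ : Measure Ω) (T : Ω → ℕ∞) : Prop where
  randomized : IsRandomizedStoppingTime P X μ T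
  finite : ∀ᵐ ω ∂μ, T ω ≠ ⊤
  law : ∀ s : S, μ {ω | X (T ω).toNat ω = s} = ENNReal.ofReal (π s)
  indep : IndepFun (fun ω => X (T ω).toNat ω) T μ

/-- The hitting time `inf {t ≥ 0 : X_t = j}`, which is `∞` if `j` is never visited. -/
noncomputable def hitTime (X : ℕ → Ω → S) (j : S) : Ω → ℕ∞ :=
  hittingAfter X {j} 0

end Chains

/-- The usual stochastic order `Y ≥_st Z` for random variables with values in `ℕ`:
`E h(Y) ≥ E h(Z)` for all increasing `h`. Since `h ≥ h 0`, both expectations exist in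
`(-∞, ∞]`, and one equals `+∞` exactly when the variable is not integrable; hence the
inequality says that if `E h(Y)` is finite then so is `E h(Z)`, and it is at most `E h(Y)`. -/
def StochDominates {Ω Ω' : Type*} [MeasurableSpace Ω] [MeasurableSpace Ω']
    (Y : Ω → ℕ) (μ : Measure Ω) (Z : Ω' → ℕ) (μ' : Measure Ω') : Prop :=
  ∀ h : ℕ → ℝ, Monotone h → Integrable (fun ω => h (Y ω)) μ →
    Integrable (fun ω => h (Z ω)) μ' ∧ ∫ ω, h (Z ω) ∂μ' ≤ ∫ ω, h (Y ω) ∂μ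

end HitGeom

/-! Write `q t = P(W_j > t)`, `a = 1 - π j`, and let `p`, `r` be the mass function and tail of `T`.
Started from `π`, the chain is at `j` with probability `π j`; otherwise it starts from `restrictAway
π j`. In the latter case, avoiding `j` up to `t` forces either `T > t`, or `T = s ≤ t` with the
chain, then stationary and independent of `s`, avoiding `j` on `[s, t]`. Hence `q ≤ a (r + p * q)`,
with `*` convolution (`IsStrongStationaryTime.measure_avoid_le`).

The tail of the geometric sum `U` solves the same equation with equality
(`measure_lt_geometric_sum`), and induction on `t` compares the two (`renewal_comparison`). As `U`
is finite, its tail tends to zero, so `W_j` is almost surely finite; tail comparison gives the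
stochastic order. -/

namespace HitGeom

/-! ### Stochastic order from tails -/

section StochasticOrder

/-- Layer-cake formula for an increasing function of a natural-valued random variable. -/
lemma lintegral_monotone_comp {Ω : Type*} [MeasurableSpace Ω] {μ : Measure Ω} {Y : Ω → ℕ}
    (hY : Measurable Y) {h : ℕ → ℝ} (hh : Monotone h) :
    ∫⁻ ω, ENNReal.ofReal (h (Y ω) - h 0) ∂μ =
      ∑' n, ENNReal.ofReal (h (n + 1) - h n) * μ {ω | n < Y ω} := by
  have hm : ∀ n, MeasurableSet {ω | n < Y ω} := fun n => hY measurableSet_Ioi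
  have key : ∀ k, ENNReal.ofReal (h k - h 0) =
      ∑' n, if n < k then ENNReal.ofReal (h (n + 1) - h n) else 0 := by
    intro k
    rw [tsum_eq_sum (s := Finset.range k) (by intro n hn; simp_all), Finset.sum_congr rfl
      (g := fun n => ENNReal.ofReal (h (n + 1) - h n)) (by intro n hn; simp_all),
      ← ENNReal.ofReal_sum_of_nonneg (fun n _ => sub_nonneg.2 (hh n.le_succ)),
      Finset.sum_range_sub]
  have h2 : ∀ ω, ENNReal.ofReal (h (Y ω) - h 0) =
      ∑' n, {ω | n < Y ω}.indicator (fun _ => ENNReal.ofReal (h (n + 1) - h n)) ω := by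
    intro ω
    rw [key]
    exact tsum_congr fun n => by simp [Set.indicator_apply]
  simp_rw [h2]
  rw [lintegral_tsum fun n => (measurable_const.indicator (hm n)).aemeasurable]
  refine tsum_congr fun n => ?_
  rw [lintegral_indicator_const (hm n)]

/-- The usual stochastic order follows from the comparison of the tails. -/
lemma stochDominates_of_tail_le {Ω Ω' : Type*} [MeasurableSpace Ω] [MeasurableSpace Ω']
    {μ : Measure Ω} {μ' : Measure Ω'} [IsProbabilityMeasure μ] [IsProbabilityMeasure μ']
    {Y : Ω → ℕ} {Z : Ω' → ℕ} (hY : Measurable Y) (hZ : Measurable Z)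
    (hYZ : ∀ n, μ' {ω | n < Z ω} ≤ μ {ω | n < Y ω}) : StochDominates Y μ Z μ' := by
  intro h hh hint
  -- Subtracting `h 0` makes the integrands nonnegative, so one `ℝ≥0∞` inequality gives both
  -- integrability and the bound.
  have hle : ∫⁻ ω, ENNReal.ofReal (h (Z ω) - h 0) ∂μ' ≤
      ∫⁻ ω, ENNReal.ofReal (h (Y ω) - h 0) ∂μ := by
    rw [lintegral_monotone_comp hY hh, lintegral_monotone_comp hZ hh]
    exact ENNReal.tsum_le_tsum fun n => mul_le_mul_right (hYZ n) _
  have hY0 : Integrable (fun ω => h (Y ω) - h 0) μ := hint.sub (integrable_const _)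
  have hYpos : 0 ≤ᵐ[μ] fun ω => h (Y ω) - h 0 :=
    ae_of_all _ fun ω => sub_nonneg.2 (hh (Nat.zero_le _))
  have hZpos : 0 ≤ᵐ[μ'] fun ω => h (Z ω) - h 0 :=
    ae_of_all _ fun ω => sub_nonneg.2 (hh (Nat.zero_le _))
  have hZm : AEStronglyMeasurable (fun ω => h (Z ω) - h 0) μ' :=
    (((measurable_from_nat (f := h)).comp hZ).sub_const _).aestronglyMeasurable
  have hfin : ∫⁻ ω, ENNReal.ofReal (h (Y ω) - h 0) ∂μ ≠ ⊤ := hY0.lintegral_lt_top.ne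
  have hZ0 : Integrable (fun ω => h (Z ω) - h 0) μ' :=
    (lintegral_ofReal_ne_top_iff_integrable hZm hZpos).1 (ne_top_of_le_ne_top hfin hle)
  have hZi : Integrable (fun ω => h (Z ω)) μ' := by
    exact (hZ0.add (integrable_const (h 0))).congr (ae_of_all _ fun ω => sub_add_cancel _ _)
  refine ⟨hZi, ?_⟩
  have hI : ∫ ω, (h (Z ω) - h 0) ∂μ' ≤ ∫ ω, (h (Y ω) - h 0) ∂μ := by
    rw [integral_eq_lintegral_of_nonneg_ae hZpos hZm,
      integral_eq_lintegral_of_nonneg_ae hYpos hY0.aestronglyMeasurable]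
    exact ENNReal.toReal_mono hfin hle
  rw [integral_sub hZi (integrable_const _), integral_sub hint (integrable_const _)] at hI
  simpa using hI

end StochasticOrder

/-! ### Renewal inequality -/

section Renewal

/-- Comparison of a subsolution with a solution of a defective renewal equation. -/
lemma renewal_comparison {a : ℝ} {p r q u : ℕ → ℝ} (ha0 : 0 ≤ a) (ha1 : a < 1)
    (hp : ∀ s, 0 ≤ p s) (hp0 : p 0 ≤ 1)
    (hq : ∀ t, q t ≤ a * (r t + ∑ s ∈ Finset.range (t + 1), p s * q (t - s)))
    (hu : ∀ t, u t = a * (r t + ∑ s ∈ Finset.range (t + 1), p s * u (t - s))) (t : ℕ) :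
    q t ≤ u t := by
  induction t using Nat.strong_induction_on with
  | _ t ih =>
    have h1 := hq t
    have h2 := hu t
    -- The `s = 0` term contains the value at `t` itself, beyond the induction hypothesis; it is
    -- moved to the left, where the factor `1 - a * p 0` is positive.
    rw [Finset.sum_range_succ'] at h1 h2
    have h3 : ∑ s ∈ Finset.range t, p (s + 1) * q (t - (s + 1)) ≤
        ∑ s ∈ Finset.range t, p (s + 1) * u (t - (s + 1)) := by
      refine Finset.sum_le_sum fun s hs => mul_le_mul_of_nonneg_left (ih _ ?_) (hp _)
      have := Finset.mem_range.1 hs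
      omega
    simp only [Nat.sub_zero] at h1 h2
    have h4 := mul_le_mul_of_nonneg_left h3 ha0
    have h5 : a * p 0 < 1 := (mul_le_of_le_one_right ha0 hp0).trans_lt ha1
    have h6 : (1 - a * p 0) * q t ≤ (1 - a * p 0) * u t := by linarith
    exact le_of_mul_le_mul_left h6 (by linarith)

end Renewal

/-! ### Stationary vectors and avoidance probabilities -/

section Survival

variable {S : Type*} [Fintype S] [DecidableEq S]

lemma IsStationary.vecMul_pow {P : Matrix S S ℝ} {π : S → ℝ} (hπ : IsStationary P π) (n : ℕ) :
    π ᵥ* P ^ n = π := by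
  induction n with
  | zero => simp
  | succ n ih => rw [pow_succ, ← Matrix.vecMul_vecMul, ih, hπ.invariant]

/-- The stationary vector of an irreducible chain charges every state. -/
lemma IsStationary.pos {P : Matrix S S ℝ} {π : S → ℝ} (hπ : IsStationary P π)
    (hP : P.IsIrreducible) (x : S) : 0 < π x := by
  obtain ⟨y, hy⟩ : ∃ y, 0 < π y := by
    by_contra! hcon
    have h1 := hπ.mem_stdSimplex.2
    linarith [Finset.sum_nonpos fun y (_ : y ∈ Finset.univ) => hcon y]
  obtain ⟨k, -, hk⟩ := (Matrix.isIrreducible_iff_exists_pow_pos hP.nonneg).1 hP y x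
  have h2 : ∑ z, π z * (P ^ k) z x = π x := congrFun (hπ.vecMul_pow k) x
  have hPk : ∀ z, 0 ≤ (P ^ k) z x := fun z => Matrix.pow_apply_nonneg hP.nonneg k z x
  rw [← h2]
  exact (mul_pos hy hk).trans_le (Finset.single_le_sum
    (f := fun z => π z * (P ^ k) z x)
    (fun z _ => mul_nonneg (hπ.mem_stdSimplex.1 z) (hPk z)) (Finset.mem_univ y))

lemma IsStationary.lt_one [Nontrivial S] {P : Matrix S S ℝ} {π : S → ℝ} (hπ : IsStationary P π)
    (hP : P.IsIrreducible) (x : S) : π x < 1 := by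
  obtain ⟨y, hy⟩ := exists_ne x
  have h1 := hπ.mem_stdSimplex.2
  rw [← Finset.add_sum_erase _ _ (Finset.mem_univ x)] at h1
  have h2 := Finset.single_le_sum (f := π) (s := Finset.univ.erase x)
    (fun z _ => hπ.mem_stdSimplex.1 z) (Finset.mem_erase.2 ⟨hy, Finset.mem_univ y⟩)
  linarith [hπ.pos hP y]

/-- The probability that the chain with transition matrix `P` started at a given state avoids
`j` at the times `0, …, n`. -/
noncomputable def survival (P : Matrix S S ℝ) (j : S) : ℕ → S → ℝ≥0∞
  | 0, x => if x = j then 0 else 1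
  | n + 1, x => if x = j then 0 else ∑ y, ENNReal.ofReal (P x y) * survival P j n y

lemma survival_self (P : Matrix S S ℝ) (j : S) (n : ℕ) : survival P j n j = 0 := by
  cases n <;> simp [survival]

/-- The state `j` contributes nothing to either side, and off `j` the two weights differ by the
factor `1 - π j`. -/
lemma sum_restrictAway_mul_survival (P : Matrix S S ℝ) {π : S → ℝ} {j : S} (hj : π j < 1)
    (n : ℕ) :
    ∑ x, ENNReal.ofReal (π x) * survival P j n x =
      ENNReal.ofReal (1 - π j) *
        ∑ x, ENNReal.ofReal (restrictAway π j x) * survival P j n x := by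
  rw [Finset.mul_sum]
  refine Finset.sum_congr rfl fun x _ => ?_
  by_cases hx : x = j
  · simp [hx, survival_self]
  · have h1 : 0 < 1 - π j := sub_pos.2 hj
    rw [← mul_assoc, ← ENNReal.ofReal_mul h1.le, restrictAway, Pi.single_eq_of_ne hx]
    congr 2
    field_simp
    ring

variable [MeasurableSpace S] [MeasurableSingletonClass S]
variable {Ω : Type*} [mΩ : MeasurableSpace Ω] {μ : Measure Ω}

omit [DecidableEq S] in
lemma measure_eq_sum_inter_fiber {Y : Ω → S} (hY : Measurable Y) (B : Set Ω) :
    μ B = ∑ y, μ (B ∩ {ω | Y ω = y}) := by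
  have h := sum_measure_preimage_singleton (μ := μ.restrict B) (f := Y) Finset.univ
    (fun y _ => hY (measurableSet_singleton y))
  simp only [Finset.coe_univ, Set.preimage_univ, Measure.restrict_apply_univ] at h
  rw [← h]
  refine Finset.sum_congr rfl fun y _ => ?_
  rw [Measure.restrict_apply (hY (measurableSet_singleton y)), Set.inter_comm]
  rfl

/-- A one-step Markov property for a growing family of events gives the probability of
avoiding `j` during a time window. -/
lemma measure_inter_avoid {P : Matrix S S ℝ} {X : ℕ → Ω → S} (hX : ∀ t, Measurable (X t))
    (C : ℕ → Set (Set Ω)) (hC : ∀ t A x, A ∈ C t → A ∩ {ω | X t ω = x} ∈ C (t + 1))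
    (hM : ∀ t A, A ∈ C t → ∀ x y, μ (A ∩ {ω | X t ω = x} ∩ {ω | X (t + 1) ω = y}) =
      μ (A ∩ {ω | X t ω = x}) * ENNReal.ofReal (P x y)) (j : S) (n : ℕ) :
    ∀ t A x, A ∈ C t → μ (A ∩ {ω | X t ω = x} ∩ {ω | ∀ i ≤ n, X (t + i) ω ≠ j}) =
      μ (A ∩ {ω | X t ω = x}) * survival P j n x := by
  induction n with
  | zero =>
    intro t A x _
    by_cases hx : x = j
    · have : A ∩ {ω | X t ω = x} ∩ {ω | ∀ i ≤ 0, X (t + i) ω ≠ j} = ∅ := by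
        ext ω; simp only [Set.mem_inter_iff, Set.mem_ofPred_eq, nonpos_iff_eq_zero, forall_eq,
          Set.mem_empty_iff_false, add_zero]; grind
      rw [this]; simp [survival, hx]
    · have : A ∩ {ω | X t ω = x} ∩ {ω | ∀ i ≤ 0, X (t + i) ω ≠ j} = A ∩ {ω | X t ω = x} := by
        ext ω; simp only [Set.mem_inter_iff, Set.mem_ofPred_eq, nonpos_iff_eq_zero, forall_eq,
          add_zero]; grind
      rw [this]; simp [survival, hx]
  | succ n ih =>
    intro t A x hA
    by_cases hx : x = j
    · have : A ∩ {ω | X t ω = x} ∩ {ω | ∀ i ≤ n + 1, X (t + i) ω ≠ j} = ∅ := by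
        refine Set.eq_empty_iff_forall_notMem.2 fun ω hω => ?_
        exact hω.2 0 (Nat.zero_le _) (hω.1.2.trans hx)
      rw [this]; simp [survival, hx]
    · rw [measure_eq_sum_inter_fiber (hX (t + 1))]
      simp only [survival, hx, if_false]
      rw [Finset.mul_sum]
      refine Finset.sum_congr rfl fun y _ => ?_
      have : A ∩ {ω | X t ω = x} ∩ {ω | ∀ i ≤ n + 1, X (t + i) ω ≠ j} ∩
          {ω | X (t + 1) ω = y} = A ∩ {ω | X t ω = x} ∩ {ω | X (t + 1) ω = y} ∩
          {ω | ∀ i ≤ n, X (t + 1 + i) ω ≠ j} := by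
        ext ω
        simp only [Set.mem_inter_iff, Set.mem_ofPred_eq]
        constructor
        · rintro ⟨⟨h1, h2⟩, h3⟩
          refine ⟨⟨h1, h3⟩, fun i hi => ?_⟩
          have := h2 (i + 1) (by omega)
          rwa [show t + (i + 1) = t + 1 + i by omega] at this
        · rintro ⟨⟨h1, h3⟩, h2⟩
          refine ⟨⟨h1, fun i hi => ?_⟩, h3⟩
          rcases i with _ | i
          · rw [add_zero, h1.2]; exact hx
          · have := h2 i (by omega)
            rwa [show t + (i + 1) = t + 1 + i by omega]
      rw [this, ih _ _ _ (hC t A x hA), hM t A hA, mul_assoc]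

/-- The tail of the hitting time of `j` for a chain given by its finite-dimensional
distributions. -/
lemma IsMarkovChain.measure_avoid {P : Matrix S S ℝ} {ν : S → ℝ} {X : ℕ → Ω → S}
    (hP : ∀ x y, 0 ≤ P x y) (hX : IsMarkovChain P ν X μ) (j : S) (n : ℕ) :
    μ {ω | ∀ i ≤ n, X i ω ≠ j} = ∑ x, ENNReal.ofReal (ν x) * survival P j n x := by
  -- The events are cylinders over times strictly before `t`, so at `t = 0` the whole space
  -- qualifies.
  have key := measure_inter_avoid (μ := μ) (P := P) hX.measurable
    (fun t => {A | ∃ x : ℕ → S, A = {ω | ∀ i < t, X i ω = x i}}) ?_ ?_ j n 0 Set.univ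
  · rw [measure_eq_sum_inter_fiber (hX.measurable 0)]
    refine Finset.sum_congr rfl fun x _ => ?_
    have h1 := key x ⟨fun _ => x, by simp⟩
    have h2 := hX.path_prob 0 (fun _ => x)
    simp only [nonpos_iff_eq_zero, forall_eq, Finset.range_zero, Finset.prod_empty,
      mul_one] at h2
    simp only [Set.univ_inter, h2, zero_add] at h1
    rw [Set.inter_comm, h1]
  · rintro t A y ⟨x, rfl⟩
    refine ⟨Function.update x t y, ?_⟩
    ext ω
    simp only [Set.mem_inter_iff, Set.mem_ofPred_eq, Nat.lt_succ_iff]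
    grind
  · rintro t A ⟨x, rfl⟩ y z
    have h1 := hX.path_prob t (Function.update x t y)
    have h2 := hX.path_prob (t + 1) (Function.update (Function.update x t y) (t + 1) z)
    have e1 : {ω | ∀ i ≤ t, X i ω = Function.update x t y i} =
        {ω | ∀ i < t, X i ω = x i} ∩ {ω | X t ω = y} := by
      ext ω
      simp only [Set.mem_inter_iff, Set.mem_ofPred_eq]
      grind
    have e2 : {ω | ∀ i ≤ t + 1, X i ω =
        Function.update (Function.update x t y) (t + 1) z i} =
        {ω | ∀ i < t, X i ω = x i} ∩ {ω | X t ω = y} ∩ {ω | X (t + 1) ω = z} := by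
      ext ω
      simp only [Set.mem_inter_iff, Set.mem_ofPred_eq]
      grind
    rw [e1] at h1
    rw [e2, Finset.prod_range_succ, ← mul_assoc, ENNReal.ofReal_mul' (hP _ _)] at h2
    rw [h2, h1]
    congr 2
    · congr 1
      refine Finset.prod_congr rfl fun i hi => ?_
      have := Finset.mem_range.1 hi
      rw [Function.update_of_ne (show i ≠ t + 1 by omega),
        Function.update_of_ne (show i + 1 ≠ t + 1 by omega)]
    · simp

/-- The chain restarted at a strong stationary time is stationary. -/
lemma IsStrongStationaryTime.measure_avoid_le {P : Matrix S S ℝ} {π : S → ℝ} {X : ℕ → Ω → S}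
    {T : Ω → ℕ∞} (hX : ∀ t, Measurable (X t)) (hT : IsStrongStationaryTime P π X μ T) (j : S)
    (t : ℕ) :
    μ {ω | ∀ i ≤ t, X i ω ≠ j} ≤ μ {ω | (t : ℕ∞) < T ω} +
      ∑ s ∈ Finset.range (t + 1), μ {ω | T ω = s} *
        ∑ x, ENNReal.ofReal (π x) * survival P j (t - s) x := by
  obtain ⟨F, hF, hM, hTF⟩ := hT.randomized
  have key := measure_inter_avoid (μ := μ) (P := P) hX
    (fun t => {A | MeasurableSet[F t] A})
    (fun t A x hA => F.mono t.le_succ _ (hA.inter (hF t (measurableSet_singleton x)))) hM j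
  -- Avoidance before `T`, or altogether when `T > t`, is discarded; this is where equality is lost.
  have hsub : {ω | ∀ i ≤ t, X i ω ≠ j} ⊆ {ω | (t : ℕ∞) < T ω} ∪
      ⋃ s ∈ Finset.range (t + 1), ({ω | T ω = s} ∩ {ω | ∀ i ≤ t - s, X (s + i) ω ≠ j}) := by
    intro ω hω
    rcases lt_or_ge (t : ℕ∞) (T ω) with h | h
    · exact Or.inl h
    · obtain ⟨s, hs⟩ := ENat.ne_top_iff_exists.1 (ne_top_of_le_ne_top (ENat.natCast_ne_top t) h)
      rw [← hs, Nat.cast_le] at h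
      refine Or.inr (Set.mem_iUnion₂.2 ⟨s, Finset.mem_range.2 (by omega), hs.symm, ?_⟩)
      exact fun i hi => hω _ (by omega)
  refine (measure_mono hsub).trans ((measure_union_le _ _).trans ?_)
  gcongr
  refine (measure_biUnion_finset_le _ _).trans (Finset.sum_le_sum fun s _ => le_of_eq ?_)
  rw [measure_eq_sum_inter_fiber (hX s), Finset.mul_sum]
  refine Finset.sum_congr rfl fun x _ => ?_
  rw [Set.inter_right_comm]
  refine (key (t - s) s _ x (hTF.measurableSet_eq s)).trans ?_
  rw [← mul_assoc]
  congr 1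
  -- On `T = s` the stopped state is `X s`, so independence gives `P(T = s, X s = x) = P(T = s) π
  -- x`.
  have h1 := (indepFun_iff_measure_inter_preimage_eq_mul.1 hT.indep) {x} {(s : ℕ∞)}
    (measurableSet_singleton x) (measurableSet_singleton _)
  have h2 : {ω | T ω = s} ∩ {ω | X s ω = x} =
      (fun ω => X (T ω).toNat ω) ⁻¹' {x} ∩ T ⁻¹' {(s : ℕ∞)} := by
    ext ω
    simp only [Set.mem_inter_iff, Set.mem_ofPred_eq, Set.mem_preimage, Set.mem_singleton_iff]
    constructor
    · rintro ⟨h, h'⟩; simp [h, h']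
    · rintro ⟨h, h'⟩; simpa [h'] using h
  refine (congrArg μ h2).trans (h1.trans ((mul_comm _ _).trans ?_))
  exact congrArg (μ {ω | T ω = s} * ·) (hT.law x)

end Survival

lemma lt_hitTime_iff {S Ω : Type*} {X : ℕ → Ω → S} {j : S} {ω : Ω} {t : ℕ} :
    (t : ℕ∞) < hitTime X j ω ↔ ∀ i ≤ t, X i ω ≠ j := by
  have h : hitTime X j ω ≤ (t : ℕ∞) ↔ ∃ i ≤ t, X i ω = j := by
    refine (hittingAfter_le_iff (u := X) (s := {j}) (n := 0) (ω := ω) (i := t)).trans ?_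
    simp
  rw [← not_le, h]
  push Not
  rfl

/-! ### Tails of geometric sums -/

section GeometricSum

variable {Ω : Type*} [MeasurableSpace Ω] {μ : Measure Ω}

/-- Either `Y` alone exceeds `t`, or `Y = s ≤ t` and `Z` must exceed `t - s`, a subtraction that
does not truncate. -/
lemma measure_lt_add_of_indepFun {Y Z : Ω → ℕ} (hY : Measurable Y) (hZ : Measurable Z)
    (hYZ : IndepFun Z Y μ) (t : ℕ) :
    μ {ω | t < Z ω + Y ω} = μ {ω | t < Y ω} +
      ∑ s ∈ Finset.range (t + 1), μ {ω | Y ω = s} * μ {ω | t - s < Z ω} := by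
  have hset : {ω | t < Z ω + Y ω} = {ω | t < Y ω} ∪
      ⋃ s ∈ Finset.range (t + 1), ({ω | t - s < Z ω} ∩ {ω | Y ω = s}) := by
    ext ω
    simp only [Set.mem_ofPred_eq, Set.mem_union, Set.mem_iUnion, Finset.mem_range,
      Set.mem_inter_iff, exists_prop]
    constructor
    · intro h
      by_cases h' : t < Y ω
      · exact Or.inl h'
      · exact Or.inr ⟨Y ω, by omega, by omega, rfl⟩
    · rintro (h | ⟨s, h1, h2, h3⟩) <;> omega
  have hm : ∀ s, MeasurableSet ({ω | t - s < Z ω} ∩ {ω | Y ω = s}) := fun s =>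
    (hZ measurableSet_Ioi).inter (hY (measurableSet_singleton s))
  rw [hset, measure_union ?_ (Finset.measurableSet_biUnion _ fun s _ => hm s),
    measure_biUnion_finset ?_ fun s _ => hm s]
  · congr 1
    refine Finset.sum_congr rfl fun s _ => ?_
    rw [mul_comm]
    exact indepFun_iff_measure_inter_preimage_eq_mul.1 hYZ (Set.Ioi (t - s)) {s}
      measurableSet_Ioi (measurableSet_singleton s)
  · intro s _ s' _ hss
    refine Set.disjoint_left.2 fun ω h1 h2 => hss ?_
    exact h1.2.symm.trans h2.2
  · refine Set.disjoint_left.2 fun ω h1 h2 => ?_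
    obtain ⟨s, hs, h3⟩ := Set.mem_iUnion₂.1 h2
    have h4 : Y ω = s := h3.2
    have h5 : t < Y ω := h1
    have := Finset.mem_range.1 hs
    omega

/-- The tail of a random sum with an independent number of terms. -/
lemma measure_lt_random_sum {τ : ℕ → Ω → ℕ} (hτ : ∀ i, Measurable (τ i)) {N : Ω → ℕ}
    (hN : Measurable N) (hNτ : IndepFun N (fun ω i => τ i ω) μ) (t : ℕ) :
    μ {ω | t < ∑ i ∈ Finset.range (N ω), τ i ω} =
      ∑' k, μ {ω | N ω = k} * μ {ω | t < ∑ i ∈ Finset.range k, τ i ω} := by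
  have hV : ∀ k, Measurable fun f : ℕ → ℕ => ∑ i ∈ Finset.range k, f i := fun k =>
    Finset.measurable_sum _ fun i _ => measurable_pi_apply i
  have hτ' : Measurable fun ω i => τ i ω := measurable_pi_lambda _ hτ
  have hset : {ω | t < ∑ i ∈ Finset.range (N ω), τ i ω} =
      ⋃ k, ({ω | N ω = k} ∩ {ω | t < ∑ i ∈ Finset.range k, τ i ω}) := by
    ext ω
    simp
  rw [hset, measure_iUnion]
  · refine tsum_congr fun k => ?_
    exact indepFun_iff_measure_inter_preimage_eq_mul.1 hNτ {k}
      ((fun f : ℕ → ℕ => ∑ i ∈ Finset.range k, f i) ⁻¹' Set.Ioi t)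
      (measurableSet_singleton k) (hV k measurableSet_Ioi)
  · intro k k' hk
    refine Set.disjoint_left.2 fun ω h1 h2 => hk ?_
    exact h1.1.symm.trans h2.1
  · exact fun k => (hN (measurableSet_singleton k)).inter
      (((hV k).comp hτ') measurableSet_Ioi)

/-- The renewal equation for the tail of a geometric sum of independent copies of `τ 0`. -/
lemma measure_lt_geometric_sum {τ : ℕ → Ω → ℕ} (hτ : ∀ i, Measurable (τ i))
    (hτi : iIndepFun τ μ) (hτd : ∀ i (A : Set ℕ), μ (τ i ⁻¹' A) = μ (τ 0 ⁻¹' A)) {N : Ω → ℕ}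
    (hN : Measurable N) (hNτ : IndepFun N (fun ω i => τ i ω) μ) {c : ℝ} (hc : c ≤ 1)
    (hNc : ∀ k : ℕ, μ {ω | N ω = k} = ENNReal.ofReal (c * (1 - c) ^ k))
    [IsProbabilityMeasure μ] (t : ℕ) :
    μ {ω | t < ∑ i ∈ Finset.range (N ω), τ i ω} = ENNReal.ofReal (1 - c) *
      (μ {ω | t < τ 0 ω} + ∑ s ∈ Finset.range (t + 1), μ {ω | τ 0 ω = s} *
        μ {ω | t - s < ∑ i ∈ Finset.range (N ω), τ i ω}) := by
  have hstep : ∀ k, μ {ω | t < ∑ i ∈ Finset.range (k + 1), τ i ω} = μ {ω | t < τ 0 ω} +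
      ∑ s ∈ Finset.range (t + 1), μ {ω | τ 0 ω = s} *
        μ {ω | t - s < ∑ i ∈ Finset.range k, τ i ω} := by
    intro k
    have hi : IndepFun (fun ω => ∑ i ∈ Finset.range k, τ i ω) (τ k) μ := by
      have := hτi.indepFun_sum_range_succ hτ k
      rwa [show ∑ i ∈ Finset.range k, τ i = fun ω => ∑ i ∈ Finset.range k, τ i ω from
        funext fun ω => Finset.sum_apply ω _ _] at this
    simp only [Finset.sum_range_succ _ k]
    rw [measure_lt_add_of_indepFun (hτ k)
      (Finset.measurable_sum _ fun i _ => hτ i) hi]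
    congr 1
    · exact hτd k (Set.Ioi t)
    · exact Finset.sum_congr rfl fun s _ => congrArg (· * _) (hτd k {s})
  have hsucc : ∀ k, μ {ω | N ω = k + 1} = ENNReal.ofReal (1 - c) * μ {ω | N ω = k} := by
    intro k
    rw [hNc, hNc, ← ENNReal.ofReal_mul (sub_nonneg.2 hc), pow_succ]
    congr 1
    ring
  have htot : ∑' k, μ {ω | N ω = k} = 1 := by
    have := tsum_measure_preimage_singleton (μ := μ) (f := N) Set.countable_univ
      (fun k _ => hN (measurableSet_singleton k))
    rw [tsum_univ (fun k => μ (N ⁻¹' {k}))] at this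
    rw [Set.preimage_univ, measure_univ] at this
    exact this
  simp only [measure_lt_random_sum hτ hN hNτ]
  -- The empty sum at `k = 0` never exceeds `t`; shifting the others by one produces the factor `1 -
  -- c` and frees one summand.
  rw [tsum_eq_zero_add' ENNReal.summable]
  simp only [Finset.range_zero, Finset.sum_empty, not_lt_zero, Set.ofPred_false, measure_empty,
    mul_zero, zero_add, hsucc, hstep]
  simp only [mul_assoc, ENNReal.tsum_mul_left]
  congr 1
  simp only [mul_add, ENNReal.tsum_add, ENNReal.tsum_mul_right, htot, one_mul]
  congr 1
  simp only [Finset.mul_sum]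
  rw [Summable.tsum_finsetSum fun _ _ => ENNReal.summable]
  refine Finset.sum_congr rfl fun s _ => ?_
  rw [← ENNReal.tsum_mul_left]
  exact tsum_congr fun k => mul_left_comm _ _ _

end GeometricSum

end HitGeom

/-! ### Comparison of the hitting time with the geometric sum -/

theorem mainTheorem2
    {S : Type*} [Fintype S] [DecidableEq S] [Nontrivial S]
    [MeasurableSpace S] [MeasurableSingletonClass S]
    (P : Matrix S S ℝ) (hP : HitGeom.IsErgodicTransitionMatrix P)
    (π : S → ℝ) (hπ : HitGeom.IsStationary P π) (j : S)
    -- the chain started from stationarity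
    {Ω₁ : Type*} [MeasurableSpace Ω₁] (μ₁ : Measure Ω₁) [IsProbabilityMeasure μ₁]
    (X : ℕ → Ω₁ → S) (hX : HitGeom.IsMarkovChain P π X μ₁)
    -- the chain started from `π` restricted to the states other than `j`,
    -- with a strong stationary time `T`
    {Ω₂ : Type*} [MeasurableSpace Ω₂] (μ₂ : Measure Ω₂) [IsProbabilityMeasure μ₂]
    (X' : ℕ → Ω₂ → S) (hX' : HitGeom.IsMarkovChain P (HitGeom.restrictAway π j) X' μ₂)
    (T : Ω₂ → ℕ∞) (hT : HitGeom.IsStrongStationaryTime P π X' μ₂ T)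
    -- the geometric sum `U` of independent copies of `T`
    {Ω₃ : Type*} [MeasurableSpace Ω₃] (μ₃ : Measure Ω₃) [IsProbabilityMeasure μ₃]
    (τ : ℕ → Ω₃ → ℕ) (hτm : ∀ i, Measurable (τ i)) (hτi : iIndepFun τ μ₃)
    (hτT : ∀ i, IdentDistrib (fun ω => (τ i ω : ℕ∞)) T μ₃ μ₂)
    (N : Ω₃ → ℕ) (hNm : Measurable N)
    (hN : ∀ k : ℕ, μ₃ {ω | N ω = k} = ENNReal.ofReal (π j * (1 - π j) ^ k))
    (hNτ : IndepFun N (fun ω i => τ i ω) μ₃)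
    (U : Ω₃ → ℕ) (hU : ∀ ω, U ω = ∑ i ∈ Finset.range (N ω), τ i ω) :
    (∀ᵐ ω ∂μ₁, HitGeom.hitTime X j ω ≠ ⊤) ∧
      HitGeom.StochDominates U μ₃ (fun ω => (HitGeom.hitTime X j ω).toNat) μ₁ := by
  have hP0 := hP.irreducible.nonneg
  have hj0 : 0 < π j := hπ.pos hP.irreducible j
  have hj1 : π j < 1 := hπ.lt_one hP.irreducible j
  have hUe : U = fun ω => ∑ i ∈ Finset.range (N ω), τ i ω := funext hU
  have hUm : Measurable U := by
    have h : Measurable fun p : ℕ × Ω₃ => ∑ i ∈ Finset.range p.1, τ i p.2 :=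
      measurable_from_prod_countable_right fun k =>
        Finset.measurable_sum (Finset.range k) fun i _ => hτm i
    rw [hUe]
    exact h.comp (hNm.prodMk measurable_id)
  have hdist : ∀ i (A : Set ℕ), μ₃ (τ i ⁻¹' A) = μ₂ (T ⁻¹' (Nat.cast '' A)) := by
    intro i A
    rw [← (hτT i).measure_mem_eq (Set.to_countable _).measurableSet]
    congr 1
    ext ω
    simp
  have hp : ∀ s : ℕ, μ₃ {ω | τ 0 ω = s} = μ₂ {ω | T ω = s} := by
    intro s
    have := hdist 0 {s}
    rwa [Set.image_singleton] at this
  have hr : ∀ t : ℕ, μ₃ {ω | t < τ 0 ω} = μ₂ {ω | (t : ℕ∞) < T ω} := by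
    intro t
    rw [show {ω | t < τ 0 ω} = τ 0 ⁻¹' Set.Ioi t from rfl, hdist]
    -- The image of `Set.Ioi t` misses `⊤`, so the two events agree only where `T` is finite.
    refine measure_congr ?_
    filter_upwards [hT.finite] with ω hω
    obtain ⟨s, hs⟩ := ENat.ne_top_iff_exists.1 hω
    refine propext ?_
    change T ω ∈ Nat.cast '' Set.Ioi t ↔ (t : ℕ∞) < T ω
    simp [← hs]
  have hu : ∀ t, μ₃ {ω | t < U ω} = ENNReal.ofReal (1 - π j) * (μ₂ {ω | (t : ℕ∞) < T ω} +
      ∑ s ∈ Finset.range (t + 1), μ₂ {ω | T ω = s} * μ₃ {ω | t - s < U ω}) := by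
    intro t
    have := HitGeom.measure_lt_geometric_sum hτm hτi
      (fun i A => (hdist i A).trans (hdist 0 A).symm) hNm hNτ hj1.le hN t
    simpa only [hr, hp, ← hU] using this
  have hq : ∀ t, μ₁ {ω | ∀ i ≤ t, X i ω ≠ j} ≤ ENNReal.ofReal (1 - π j) *
      (μ₂ {ω | (t : ℕ∞) < T ω} + ∑ s ∈ Finset.range (t + 1), μ₂ {ω | T ω = s} *
        μ₁ {ω | ∀ i ≤ t - s, X i ω ≠ j}) := by
    intro t
    simp only [hX.measure_avoid hP0 j]
    rw [HitGeom.sum_restrictAway_mul_survival P hj1, ← hX'.measure_avoid hP0 j]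
    gcongr
    exact hT.measure_avoid_le hX'.measurable j t
  have hle : ∀ t, μ₁ {ω | ∀ i ≤ t, X i ω ≠ j} ≤ μ₃ {ω | t < U ω} := by
    intro t
    -- The renewal comparison subtracts, hence the passage to real numbers.
    rw [← ENNReal.toReal_le_toReal (measure_ne_top _ _) (measure_ne_top _ _)]
    have hreal : ∀ f : ℕ → ℝ≥0∞, (∀ s, f s ≠ ⊤) → ∀ t : ℕ, (ENNReal.ofReal (1 - π j) *
        (μ₂ {ω | (t : ℕ∞) < T ω} + ∑ s ∈ Finset.range (t + 1), μ₂ {ω | T ω = s} *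
          f (t - s))).toReal = (1 - π j) * ((μ₂ {ω | (t : ℕ∞) < T ω}).toReal +
        ∑ s ∈ Finset.range (t + 1), (μ₂ {ω | T ω = s}).toReal * (f (t - s)).toReal) := by
      intro f hf t
      have hm : ∀ s ∈ Finset.range (t + 1), μ₂ {ω | T ω = s} * f (t - s) ≠ ⊤ :=
        fun s _ => ENNReal.mul_ne_top (measure_ne_top _ _) (hf _)
      rw [ENNReal.toReal_mul, ENNReal.toReal_ofReal (sub_nonneg.2 hj1.le),
        ENNReal.toReal_add (measure_ne_top _ _) (ENNReal.sum_ne_top.2 hm),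
        ENNReal.toReal_sum hm]
      simp only [ENNReal.toReal_mul]
    refine HitGeom.renewal_comparison (a := 1 - π j) (p := fun s => (μ₂ {ω | T ω = s}).toReal)
      (r := fun t => (μ₂ {ω | (t : ℕ∞) < T ω}).toReal)
      (q := fun t => (μ₁ {ω | ∀ i ≤ t, X i ω ≠ j}).toReal)
      (u := fun t => (μ₃ {ω | t < U ω}).toReal) (sub_nonneg.2 hj1.le) (by linarith)
      (fun s => ENNReal.toReal_nonneg) (measureReal_le_one (μ := μ₂)) (fun t => ?_)
      (fun t => ?_) t
    · refine (ENNReal.toReal_mono ?_ (hq t)).trans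
        (hreal (fun s => μ₁ {ω | ∀ i ≤ s, X i ω ≠ j}) (fun s => measure_ne_top _ _) t).le
      exact ENNReal.mul_ne_top ENNReal.ofReal_ne_top (ENNReal.add_ne_top.2
        ⟨measure_ne_top _ _, ENNReal.sum_ne_top.2 fun s _ =>
          ENNReal.mul_ne_top (measure_ne_top _ _) (measure_ne_top _ _)⟩)
    · exact (congrArg ENNReal.toReal (hu t)).trans
        (hreal (fun s => μ₃ {ω | s < U ω}) (fun s => measure_ne_top _ _) t)
  have hfin : ∀ᵐ ω ∂μ₁, HitGeom.hitTime X j ω ≠ ⊤ := by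
    have hlim : Filter.Tendsto (fun t => μ₃ {ω | t < U ω}) Filter.atTop (nhds 0) := by
      have h := tendsto_measure_iInter_atTop (μ := μ₃) (s := fun t : ℕ => {ω | t < U ω})
        (fun t => (hUm measurableSet_Ioi).nullMeasurableSet)
        (fun a b hab ω hω => lt_of_le_of_lt hab hω) ⟨0, measure_ne_top _ _⟩
      have hempty : ⋂ t : ℕ, {ω | t < U ω} = ∅ :=
        Set.eq_empty_iff_forall_notMem.2 fun ω hω =>
          lt_irrefl (U ω) (Set.mem_iInter.1 hω (U ω))
      rwa [hempty, measure_empty] at h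
    rw [ae_iff]
    refine le_antisymm (ge_of_tendsto' hlim fun t => (measure_mono ?_).trans (hle t)) bot_le
    intro ω hω
    have hω' : HitGeom.hitTime X j ω = ⊤ := not_not.1 hω
    refine HitGeom.lt_hitTime_iff.1 ?_
    rw [hω']
    exact ENat.natCast_lt_top t
  refine ⟨hfin, ?_⟩
  have hav : ∀ t, MeasurableSet {ω | ∀ i ≤ t, X i ω ≠ j} := fun t => by
    simp only [Set.ofPred_forall]
    exact MeasurableSet.iInter fun i => MeasurableSet.iInter fun _ =>
      (hX.measurable i (measurableSet_singleton j)).compl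
  have htm : Measurable fun ω => (HitGeom.hitTime X j ω).toNat := by
    refine measurable_of_Ioi fun t => ?_
    -- Since `toNat` sends `⊤` to `0`, paths that never visit `j` must be removed.
    convert (hav t).diff (MeasurableSet.iInter hav) using 1
    ext ω
    simp only [Set.mem_preimage, Set.mem_Ioi, Set.mem_sdiff, Set.mem_iInter, Set.mem_ofPred_eq,
      ← HitGeom.lt_hitTime_iff]
    rcases eq_or_ne (HitGeom.hitTime X j ω) ⊤ with h | h
    · simp [h]
    · obtain ⟨s, hs⟩ := ENat.ne_top_iff_exists.1 h
      rw [← hs]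
      simp only [ENat.toNat_natCast, Nat.cast_lt]
      exact ⟨fun hts => ⟨hts, fun hall => lt_irrefl s (hall s)⟩, And.left⟩
  refine HitGeom.stochDominates_of_tail_le hUm htm fun t => ?_
  refine le_trans (measure_mono fun ω hω => ?_) (hle t)
  refine HitGeom.lt_hitTime_iff.1 ?_
  have h1 : t < (HitGeom.hitTime X j ω).toNat := hω
  exact lt_of_lt_of_le (Nat.cast_lt.2 h1) (ENat.natCast_toNat_le_self _)
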